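/- For nonzero integers $m,n$ let $BS(m,n)=\langle a,t \mid t^{-1}a^m t=a^n\rangle$ be the Baumslag–Solitar group. A group $G$ is called residually nilpotent if for every $g\in G$ with $g\neq 1$ there is a homomorphism $\varphi$ from $G$ to a nilpotent group with $\varphi(g)\neq 1$. **Theorem 2.** Let $m,n$ be integers with $0<m\le |n|$. Then $BS(m,n)$ is residually nilpotent if and only if either $m=1$ and $n\neq 2$, or $|n|=m>1$ and $m$ is a power of a prime number. -/

import Mathlib

/-- The two generators of a Baumslag–Solitar group. -/
inductive BSGen : Type
  | a : BSGen
  | t : BSGen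

/-- The relator `t⁻¹ a ^ m t (a ^ n)⁻¹`, expressing `t⁻¹ a ^ m t = a ^ n`. -/
def bsRelator (m n : ℤ) : FreeGroup BSGen :=
  (FreeGroup.of BSGen.t)⁻¹ * FreeGroup.of BSGen.a ^ m * FreeGroup.of BSGen.t *
    (FreeGroup.of BSGen.a ^ n)⁻¹

/-- The Baumslag–Solitar group `BS(m, n) = ⟨a, t | t⁻¹ a ^ m t = a ^ n⟩`. -/
abbrev BaumslagSolitar (m n : ℤ) : Type :=
  PresentedGroup {bsRelator m n}

/-- A group is residually nilpotent if every non-identity element has non-identity image under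
some homomorphism to a nilpotent group. (The image of such a homomorphism is nilpotent and lies in
the universe of `G` up to isomorphism, so the universe of `N` does not matter.) -/
def IsResiduallyNilpotent.{u} (G : Type u) [Group G] : Prop :=
  ∀ g : G, g ≠ 1 → ∃ (N : Type u) (_ : Group N) (_ : Group.IsNilpotent N) (φ : G →* N), φ g ≠ 1

/-! Britton's lemma supplies pairs of non-commuting elements of BS(m, n). If 1 < m < |n|, the image
of `a` in a nilpotent group has finite order, which forces `a` to commute with `t a^d t⁻¹`, d =
gcd(m, n). If |n| = m = uv with u, v > 1 coprime, `a^u` and `t⁻¹ a^v t` commute in every nilpotent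
image. In BS(1, 2) the generator `a` itself dies.

Conversely, for m = 1 every element is `t^i a^j t^(-l)`. Either the exponent sum of `t` detects it,
or it is conjugate to `a^j`, which survives in a p-group Z/p^(k+1) ⋊ ⟨n⟩ with p ∣ n - 1. For |n| = m
= p^k, the kernel of the map onto Z/p^k * Z is ⟨a^m⟩, whose elements are detected in BS(1, ±1). The
free product is residually nilpotent because a reduced word can be spelled out along the
superdiagonal of unitriangular matrices over F_p. -/

namespace BaumslagSolitar

variable {m n : ℤ} {G : Type*} [Group G]

/-- The generator `a` of `BS(m, n)`. -/
def a (m n : ℤ) : BaumslagSolitar m n := PresentedGroup.of BSGen.a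

/-- The generator `t` of `BS(m, n)`. -/
def t (m n : ℤ) : BaumslagSolitar m n := PresentedGroup.of BSGen.t

theorem relation (m n : ℤ) : (t m n)⁻¹ * a m n ^ m * t m n = a m n ^ n := by
  have h : PresentedGroup.mk {bsRelator m n} (bsRelator m n) = 1 :=
    PresentedGroup.one_of_mem (Set.mem_singleton _)
  exact mul_inv_eq_one.1 h

/-- The homomorphism from `BS(m, n)` given by two elements satisfying the relation. -/
def lift (x y : G) (h : y⁻¹ * x ^ m * y = x ^ n) : BaumslagSolitar m n →* G :=
  PresentedGroup.toGroup (f := fun | .a => x | .t => y) (by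
    rintro _ rfl
    simp [bsRelator, h])

@[simp]
theorem lift_a (x y : G) (h : y⁻¹ * x ^ m * y = x ^ n) : lift x y h (a m n) = x :=
  PresentedGroup.toGroup.of _

@[simp]
theorem lift_t (x y : G) (h : y⁻¹ * x ^ m * y = x ^ n) : lift x y h (t m n) = y :=
  PresentedGroup.toGroup.of _

theorem map_relation (φ : BaumslagSolitar m n →* G) :
    (φ (t m n))⁻¹ * φ (a m n) ^ m * φ (t m n) = φ (a m n) ^ n := by
  simpa using congrArg φ (relation m n)

theorem hom_ext {φ ψ : BaumslagSolitar m n →* G} (ha : φ (a m n) = ψ (a m n))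
    (ht : φ (t m n) = ψ (t m n)) : φ = ψ :=
  PresentedGroup.ext fun x => by cases x <;> assumption

theorem closure_eq_top (m n : ℤ) :
    Subgroup.closure {a m n, t m n} = (⊤ : Subgroup (BaumslagSolitar m n)) := by
  rw [← PresentedGroup.closure_range_of]
  congr 1
  ext x
  constructor
  · rintro (rfl | rfl)
    exacts [⟨_, rfl⟩, ⟨_, rfl⟩]
  · rintro ⟨i, rfl⟩
    cases i
    exacts [Or.inl rfl, Or.inr rfl]

end BaumslagSolitar

/-! ### Non-commuting elements via Britton's lemma -/

namespace HNNExtension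

variable {G : Type*} [Group G] {A B : Subgroup G} {φ : A ≃* B}

/-- The commutator, written out, is a reduced word of length four in the stable letter. -/
theorem not_commute_of_conj_t (ε : ℤˣ) {x y : G} (hx : x ∉ toSubgroup A B (-ε))
    (hy : y ∉ toSubgroup A B ε) :
    ¬ Commute (of x : HNNExtension G A B φ) (t ^ (ε : ℤ) * of y * t ^ (-ε : ℤ)) := by
  intro h
  let w : NormalWord.ReducedWord G A B :=
    { head := x
      toList := [(ε, y), (-ε, x⁻¹), (ε, y⁻¹), (-ε, 1)]
      chain := by simp [hx, hy] }
  have hw : w.prod φ = 1 := by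
    have h' := mul_inv_eq_one.2 h.eq
    rw [← h']
    simp [w, NormalWord.ReducedWord.prod, mul_assoc]
  have := ReducedWord.toList_eq_nil_of_mem_of_range φ w (by rw [hw]; exact one_mem _)
  simp [w] at this

end HNNExtension

namespace BaumslagSolitar

variable {m n : ℤ}

/-- The subgroup of `k`-th powers of the infinite cyclic group. -/
abbrev powers (k : ℤ) : Subgroup (Multiplicative ℤ) := (zpowGroupHom k).range

theorem zpowGroupHom_injective {k : ℤ} (hk : k ≠ 0) :
    Function.Injective (zpowGroupHom k : Multiplicative ℤ →* Multiplicative ℤ) :=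
  fun x y h => Multiplicative.toAdd.injective <|
    mul_left_cancel₀ hk (by simpa using congrArg Multiplicative.toAdd h)

theorem mem_powers_iff {k x : ℤ} : Multiplicative.ofAdd x ∈ powers k ↔ k ∣ x := by
  constructor
  · rintro ⟨y, hy⟩
    exact ⟨y.toAdd, by simpa using (congrArg Multiplicative.toAdd hy).symm⟩
  · rintro ⟨y, rfl⟩
    exact ⟨Multiplicative.ofAdd y, Multiplicative.toAdd.injective (by simp [mul_comm])⟩

/-- The isomorphism of subgroups of the infinite cyclic group sending `m`-th to `n`-th powers. -/
noncomputable def powersEquiv (hm : m ≠ 0) (hn : n ≠ 0) : powers m ≃* powers n :=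
  (MonoidHom.ofInjective (zpowGroupHom_injective hm)).symm.trans
    (MonoidHom.ofInjective (zpowGroupHom_injective hn))

theorem powersEquiv_ofInjective (hm : m ≠ 0) (hn : n ≠ 0) (x : Multiplicative ℤ) :
    powersEquiv hm hn (MonoidHom.ofInjective (zpowGroupHom_injective hm) x) =
      MonoidHom.ofInjective (zpowGroupHom_injective hn) x := by
  rw [powersEquiv, MulEquiv.trans_apply, MulEquiv.symm_apply_apply]

/-- The homomorphism from `BS(m, n)` to the corresponding HNN extension. -/
noncomputable def toHNN (hm : m ≠ 0) (hn : n ≠ 0) :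
    BaumslagSolitar m n →* HNNExtension _ _ _ (powersEquiv hm hn) :=
  -- The stable letter is inverted: in `HNNExtension`, `t x t⁻¹ = φ x`.
  lift (HNNExtension.of (Multiplicative.ofAdd 1)) HNNExtension.t⁻¹ <| by
    have h := HNNExtension.equiv_eq_conj (φ := powersEquiv hm hn)
      (MonoidHom.ofInjective (zpowGroupHom_injective hm) (Multiplicative.ofAdd 1))
    rw [powersEquiv_ofInjective] at h
    simpa [-map_zpow, MonoidHom.ofInjective_apply, ← map_zpow HNNExtension.of] using h.symm

theorem toHNN_a_zpow (hm : m ≠ 0) (hn : n ≠ 0) (k : ℤ) :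
    toHNN hm hn (a m n ^ k) = HNNExtension.of (Multiplicative.ofAdd k) := by
  rw [map_zpow, toHNN, lift_a, ← map_zpow, ← ofAdd_zsmul]
  simp

theorem a_zpow_ne_one (hm : m ≠ 0) (hn : n ≠ 0) {k : ℤ} (hk : k ≠ 0) : a m n ^ k ≠ 1 := by
  intro h
  have h' := toHNN_a_zpow hm hn k
  rw [h, map_one, ← map_one HNNExtension.of] at h'
  exact hk (ofAdd_eq_one.1 (HNNExtension.of_injective _ h').symm)

theorem not_commute_conj_inv (hm : m ≠ 0) (hn : n ≠ 0) {x y : ℤ} (hx : ¬ n ∣ x) (hy : ¬ m ∣ y) :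
    ¬ Commute (a m n ^ x) ((t m n)⁻¹ * a m n ^ y * t m n) := by
  intro h
  refine HNNExtension.not_commute_of_conj_t (φ := powersEquiv hm hn) 1
    (x := .ofAdd x) (y := .ofAdd y) (mt mem_powers_iff.1 hx) (mt mem_powers_iff.1 hy) ?_
  have ht : toHNN hm hn (t m n) = HNNExtension.t⁻¹ := by simp [toHNN]
  simpa [-map_zpow, toHNN_a_zpow, ht] using h.map (toHNN hm hn)

theorem not_commute_conj (hm : m ≠ 0) (hn : n ≠ 0) {x y : ℤ} (hx : ¬ m ∣ x) (hy : ¬ n ∣ y) :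
    ¬ Commute (a m n ^ x) (t m n * a m n ^ y * (t m n)⁻¹) := by
  intro h
  refine HNNExtension.not_commute_of_conj_t (φ := powersEquiv hm hn) (-1)
    (x := .ofAdd x) (y := .ofAdd y) (by simpa using mt mem_powers_iff.1 hx)
    (mt mem_powers_iff.1 hy) ?_
  have ht : toHNN hm hn (t m n) = HNNExtension.t⁻¹ := by simp [toHNN]
  simpa [-map_zpow, toHNN_a_zpow, ht] using h.map (toHNN hm hn)

end BaumslagSolitar

/-! ### Commutation and torsion in nilpotent groups -/

/-- Modulo the centre, induction applies, so z = [x, y] is central. Then z^u = [x^u, y] = 1 and z^v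
= [x, y^v] = 1. -/
theorem Group.IsNilpotent.commute_of_coprime {G : Type*} [Group G] [Group.IsNilpotent G] {u v : ℕ}
    (huv : u.Coprime v) {x y : G} (hx : Commute (x ^ u) y) (hy : Commute x (y ^ v)) :
    Commute x y := by
  revert x y
  refine Group.nilpotent_center_quotient_ind (P := fun G _ _ => ∀ {x y : G},
    Commute (x ^ u) y → Commute x (y ^ v) → Commute x y) G ?_ ?_
  · intro G _ _ x y _ _
    exact Subsingleton.elim _ _
  · intro G _ _ ih x y hx hy
    have h := ih (x := QuotientGroup.mk' (Subgroup.center G) x)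
      (y := QuotientGroup.mk' (Subgroup.center G) y)
      (by simpa using hx.map (QuotientGroup.mk' (Subgroup.center G)))
      (by simpa using hy.map (QuotientGroup.mk' (Subgroup.center G)))
    obtain ⟨z, hz, hxy⟩ : ∃ z ∈ Subgroup.center G, x * y * x⁻¹ = z * y := by
      refine ⟨x * y * x⁻¹ * y⁻¹, ?_, by group⟩
      rw [← QuotientGroup.eq_one_iff]
      simpa [mul_inv_eq_one, mul_inv_eq_iff_eq_mul] using h.eq
    have hzc : ∀ g, Commute z g := fun g => (Subgroup.mem_center_iff.1 hz g).symm
    have hv : z ^ v = 1 := by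
      have h1 : x * y ^ v * x⁻¹ = z ^ v * y ^ v := by
        rw [← conj_pow, hxy, (hzc y).mul_pow]
      rw [hy.eq, mul_inv_cancel_right] at h1
      exact (mul_eq_right.1 h1.symm)
    have hu : z ^ u = 1 := by
      have h1 : ∀ k : ℕ, x ^ k * y = z ^ k * y * x ^ k := by
        intro k
        induction k with
        | zero => simp
        | succ k ih =>
          rw [pow_succ', mul_assoc, ih, ← mul_assoc, ← mul_assoc, ← ((hzc x).pow_left k).eq,
            mul_assoc (z ^ k), mul_inv_eq_iff_eq_mul.1 hxy, pow_succ z]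
          simp only [mul_assoc]
      have h2 := h1 u
      rw [hx.eq, mul_assoc] at h2
      exact mul_eq_right.1 h2.symm
    have hz1 : z = 1 := by
      rw [← orderOf_eq_one_iff]
      exact Nat.eq_one_of_dvd_coprimes huv (orderOf_dvd_of_pow_eq_one hu)
        (orderOf_dvd_of_pow_eq_one hv)
    rw [hz1, one_mul] at hxy
    exact mul_inv_eq_iff_eq_mul.1 hxy

/-- If x^s is central, conjugating x^(sm) by y changes nothing, yet gives x^(sn); hence x^(s(n - m))
= 1. -/
theorem Group.IsNilpotent.exists_zpow_eq_one_of_conj {G : Type*} [Group G] [Group.IsNilpotent G]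
    {m n : ℤ} {x y : G} (h : y⁻¹ * x ^ m * y = x ^ n) : ∃ c : ℕ, x ^ ((n - m) ^ c) = 1 := by
  revert x y
  refine Group.nilpotent_center_quotient_ind (P := fun G _ _ => ∀ {x y : G},
    y⁻¹ * x ^ m * y = x ^ n → ∃ c : ℕ, x ^ ((n - m) ^ c) = 1) G ?_ ?_
  · intro G _ _ x y _
    exact ⟨1, Subsingleton.elim _ _⟩
  · intro G _ _ ih x y h
    obtain ⟨c, hxs⟩ := ih (x := QuotientGroup.mk' (Subgroup.center G) x)
      (y := QuotientGroup.mk' (Subgroup.center G) y) (by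
        simpa using congrArg (QuotientGroup.mk' (Subgroup.center G)) h)
    rw [← map_zpow] at hxs
    set s := (n - m) ^ c
    have hc : x ^ s ∈ Subgroup.center G := (QuotientGroup.eq_one_iff _).1 hxs
    refine ⟨c + 1, ?_⟩
    have h1 : x ^ (s * n) = x ^ (s * m) := by
      calc x ^ (s * n) = (y⁻¹ * x ^ m * y) ^ s := by rw [h, ← zpow_mul, mul_comm]
        _ = y⁻¹ * (x ^ s) ^ m * y := by
          have := conj_zpow (i := s) (a := y⁻¹) (b := x ^ m)
          rw [inv_inv] at this
          rw [this, ← zpow_mul, ← zpow_mul, mul_comm]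
        _ = x ^ (s * m) := by
          rw [← Subgroup.mem_center_iff.1 (zpow_mem hc m) y⁻¹ |>.symm, mul_assoc]
          simp [zpow_mul]
    rw [pow_succ, mul_sub, zpow_sub, h1, mul_inv_cancel]

/-- The conjugates x^m and x^n have equal order, so e = gcd(n, ord x) divides m too, hence gcd(m,
n). Thus x^gcd(m, n) lies in ⟨x^e⟩ = ⟨x^n⟩ = y⁻¹⟨x^m⟩y, and conjugating back lands in ⟨x⟩. -/
theorem commute_conj_zpow_gcd {G : Type*} [Group G] {m n : ℤ} {x y : G}
    (h : y⁻¹ * x ^ m * y = x ^ n) (hx : IsOfFinOrder x) :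
    Commute x (y * x ^ (Int.gcd m n : ℤ) * y⁻¹) := by
  set d := orderOf x with hd
  have hd0 : 0 < d := hx.orderOf_pos
  set e := Int.gcd n d with he
  obtain ⟨d', hd'⟩ : (e : ℤ) ∣ d := Int.gcd_dvd_right ..
  obtain ⟨n', hn'⟩ : (e : ℤ) ∣ n := Int.gcd_dvd_left ..
  have h1 : (x ^ m) ^ d' = 1 := by
    have h2 : (y⁻¹ * x ^ m * y) ^ d' = 1 := by
      rw [h, ← zpow_mul, ← orderOf_dvd_iff_zpow_eq_one, ← hd, hd']
      exact ⟨n', by rw [hn']; ring⟩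
    have h3 := conj_zpow (i := d') (a := y⁻¹) (b := x ^ m)
    rw [inv_inv, h2] at h3
    simpa [mul_eq_one_iff_eq_inv] using h3.symm
  have hem : (e : ℤ) ∣ m := by
    rw [← zpow_mul, ← orderOf_dvd_iff_zpow_eq_one, ← hd, hd'] at h1
    refine Int.dvd_of_mul_dvd_mul_right (a := d') ?_ h1
    rintro rfl
    rw [mul_zero] at hd'
    omega
  obtain ⟨g', hg'⟩ : (e : ℤ) ∣ Int.gcd m n := Int.dvd_coe_gcd hem ⟨n', hn'⟩
  -- Bézout for e = gcd(n, d), where x^d = 1.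
  have hxe : x ^ (e : ℤ) = (x ^ n) ^ (Int.gcdA n d) := by
    rw [he, Int.gcd_eq_gcd_ab, zpow_add, zpow_mul, zpow_mul x (d : ℤ), zpow_natCast x d, hd,
      pow_orderOf_eq_one, one_zpow, mul_one]
  have hxg : x ^ (Int.gcd m n : ℤ) = y⁻¹ * x ^ (m * (Int.gcdA n d * g')) * y := by
    have h3 := conj_zpow (i := Int.gcdA n d * g') (a := y⁻¹) (b := x ^ m)
    rw [inv_inv] at h3
    rw [hg', zpow_mul, hxe, ← zpow_mul, ← h, h3, zpow_mul x m]
  rw [hxg]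
  have h4 : ∀ z : G, y * (y⁻¹ * z * y) * y⁻¹ = z := fun z => by group
  rw [h4]
  exact (Commute.refl x).zpow_right _

/-! ### Residual nilpotence of BS(1, n) -/

namespace BaumslagSolitar

/-- Since `a t = t a^n`, powers of `a` move right past positive powers of `t`, so these forms are
stable under left multiplication by the generators and their inverses. -/
theorem exists_eq_conj_zpow {n : ℤ} (g : BaumslagSolitar 1 n) :
    ∃ (i l : ℕ) (j : ℤ), g = t 1 n ^ i * a 1 n ^ j * (t 1 n ^ l)⁻¹ := by
  have hrel : a 1 n * t 1 n = t 1 n * a 1 n ^ n := by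
    rw [← relation 1 n, zpow_one]; group
  have hrel' : ∀ j : ℤ, a 1 n ^ j * t 1 n = t 1 n * a 1 n ^ (n * j) := by
    intro j
    have : SemiconjBy (t 1 n) (a 1 n ^ n) (a 1 n) := hrel.symm
    rw [zpow_mul]
    exact (this.zpow_right j).eq.symm
  have hpow : ∀ (i : ℕ) (j : ℤ), a 1 n ^ j * t 1 n ^ i = t 1 n ^ i * a 1 n ^ (n ^ i * j) := by
    intro i
    induction i with
    | zero => simp
    | succ i ih =>
      intro j
      rw [pow_succ', ← mul_assoc, hrel', mul_assoc, ih, mul_assoc, pow_succ, mul_assoc]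
  have ha : ∀ (k : ℤ) (g : BaumslagSolitar 1 n),
      (∃ (i l : ℕ) (j : ℤ), g = t 1 n ^ i * a 1 n ^ j * (t 1 n ^ l)⁻¹) →
      ∃ (i l : ℕ) (j : ℤ), a 1 n ^ k * g = t 1 n ^ i * a 1 n ^ j * (t 1 n ^ l)⁻¹ := by
    rintro k _ ⟨i, l, j, rfl⟩
    refine ⟨i, l, n ^ i * k + j, ?_⟩
    rw [← mul_assoc, ← mul_assoc, hpow, zpow_add, ← mul_assoc]
  have hg : g ∈ Subgroup.closure {a 1 n, t 1 n} := by rw [closure_eq_top]; trivial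
  induction hg using Subgroup.closure_induction_left with
  | one => exact ⟨0, 0, 0, by simp⟩
  | mul_left x hx y _ ih =>
    obtain rfl | rfl := hx
    · simpa using ha 1 y ih
    · obtain ⟨i, l, j, rfl⟩ := ih
      exact ⟨i + 1, l, j, by rw [pow_succ']; simp only [mul_assoc]⟩
  | inv_mul_cancel x hx y _ ih =>
    obtain rfl | rfl := hx
    · simpa using ha (-1) y ih
    · obtain ⟨i, l, j, rfl⟩ := ih
      cases i with
      | zero =>
        refine ⟨0, l + 1, n * j, ?_⟩
        rw [pow_zero, one_mul, one_mul, ← mul_assoc, inv_mul_eq_iff_eq_mul.2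
          ((mul_inv_eq_iff_eq_mul.2 (hrel' j).symm).symm.trans (mul_assoc _ _ _)), pow_succ,
          mul_inv_rev, mul_assoc]
      | succ i => exact ⟨i, l, j, by rw [pow_succ']; simp only [mul_assoc, inv_mul_cancel_left]⟩

/-- The action of a unit of `R` on the additive group of `R`, as a multiplicative automorphism. -/
def unitsMulAut (R : Type*) [CommRing R] : Rˣ →* MulAut (Multiplicative R) :=
  (MulAutMultiplicative R).symm.toMonoidHom.comp (AddAut.mulLeft (R := R))

theorem exists_isNilpotent_apply_ne_one {n : ℤ} (hn0 : n ≠ 0) (hn2 : n ≠ 2) {j : ℤ} (hj : j ≠ 0) :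
    ∃ (N : Type) (_ : Group N) (_ : Group.IsNilpotent N) (φ : BaumslagSolitar 1 n →* N),
      φ (a 1 n ^ j) ≠ 1 := by
  -- |n - 1| = 1 only for n = 0 and n = 2.
  obtain ⟨p, hp, hpn⟩ := Nat.exists_prime_and_dvd (n := (n - 1).natAbs) (by omega)
  have := Fact.mk hp
  have hpn : (p : ℤ) ∣ n - 1 := Int.natCast_dvd.2 hpn
  obtain ⟨k, hk⟩ : ∃ k, ¬ ((p ^ (k + 1) : ℕ) : ℤ) ∣ j := by
    refine ⟨j.natAbs, fun h => ?_⟩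
    have h1 := Nat.le_of_dvd (by omega) (Int.natCast_dvd.1 h)
    have h2 := Nat.lt_pow_self hp.one_lt (n := j.natAbs + 1)
    omega
  set q := p ^ (k + 1) with hq
  have hq0 : NeZero q := ⟨pow_ne_zero _ hp.ne_zero⟩
  -- As n ≡ 1 mod p, multiplication by n on Z/p^(k+1) has p-power order, so the semidirect product
  -- below is a p-group.
  have hpow : (n : ZMod q) ^ p ^ k = 1 := by
    have h := dvd_sub_pow_of_dvd_sub hpn k
    rw [one_pow] at h
    have h2 : ((n ^ p ^ k - 1 : ℤ) : ZMod q) = 0 := by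
      rw [ZMod.intCast_zmod_eq_zero_iff_dvd]
      exact_mod_cast h
    push_cast at h2
    exact sub_eq_zero.1 h2
  obtain ⟨u, hu⟩ : IsUnit (n : ZMod q) :=
    IsUnit.of_pow_eq_one hpow (pow_ne_zero _ hp.ne_zero)
  have hu1 : u ^ p ^ k = 1 := Units.ext (by simpa [hu] using hpow)
  let v : Subgroup.zpowers u := ⟨u, Subgroup.mem_zpowers u⟩
  let ψ := (unitsMulAut (ZMod q)).comp (Subgroup.zpowers u).subtype
  let N := Multiplicative (ZMod q) ⋊[ψ] Subgroup.zpowers u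
  obtain ⟨r, -, hr⟩ := (Nat.dvd_prime_pow hp).1 (orderOf_dvd_of_pow_eq_one hu1)
  have hcard : Nat.card N = p ^ (k + 1 + r) := by
    rw [SemidirectProduct.card, Nat.card_zpowers, hr, pow_add, ← hq]
    simp
  have : Finite N := Nat.finite_of_card_ne_zero (by rw [hcard]; exact pow_ne_zero _ hp.ne_zero)
  have hN : Group.IsNilpotent N := (IsPGroup.of_card hcard).isNilpotent
  let x : N := SemidirectProduct.inl (Multiplicative.ofAdd 1)
  -- The inverse appears because `t⁻¹ a t = a^n`: it is `t⁻¹` that acts as multiplication by n.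
  refine ⟨N, inferInstance, hN, lift x (SemidirectProduct.inr v)⁻¹ ?_, ?_⟩
  · have h := SemidirectProduct.inl_aut (φ := ψ) v (Multiplicative.ofAdd 1)
    have h1 : ψ v (Multiplicative.ofAdd 1) = Multiplicative.ofAdd 1 ^ n := by
      refine Multiplicative.toAdd.injective ?_
      change (u : ZMod q) * 1 = _
      simp [hu]
    rw [h1, map_zpow, map_inv] at h
    rw [zpow_one, inv_inv]
    exact h.symm
  · intro h
    rw [map_zpow, lift_a, ← map_zpow] at h
    have h1 := congrArg Multiplicative.toAdd
      (SemidirectProduct.inl_injective (h.trans (map_one _).symm))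
    refine hk ((ZMod.intCast_zmod_eq_zero_iff_dvd _ _).1 ?_)
    simpa using h1

theorem isResiduallyNilpotent_one {n : ℤ} (hn0 : n ≠ 0) (hn2 : n ≠ 2) :
    IsResiduallyNilpotent (BaumslagSolitar 1 n) := by
  intro g hg
  obtain ⟨i, l, j, rfl⟩ := exists_eq_conj_zpow g
  by_cases hil : i = l
  · subst hil
    have hj : j ≠ 0 := by
      rintro rfl
      simp at hg
    obtain ⟨N, hN, hN', φ, hφ⟩ := exists_isNilpotent_apply_ne_one hn0 hn2 hj
    refine ⟨N, hN, hN', φ, fun h => hφ ?_⟩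
    rwa [map_mul, map_mul, map_inv, conj_eq_one_iff] at h
  · refine ⟨Multiplicative ℤ, inferInstance, inferInstance,
      lift 1 (Multiplicative.ofAdd 1) (by simp), fun h => hil ?_⟩
    have := congrArg Multiplicative.toAdd h
    simp at this
    omega

end BaumslagSolitar

/-! ### Unitriangular matrices over F_p -/

section Unitriangular

theorem Matrix.pow_apply_eq_zero_of_strictlyUpper {R : Type*} [CommRing R] {N : ℕ}
    {X : Matrix (Fin N) (Fin N) R} (hX : ∀ i j, j ≤ i → X i j = 0) (k : ℕ) {i j : Fin N}
    (hij : (j : ℕ) < i + k) : (X ^ k) i j = 0 := by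
  induction k generalizing i j with
  | zero => simp [show i ≠ j by rintro rfl; simp at hij]
  | succ k ih =>
    rw [pow_succ, Matrix.mul_apply]
    refine Finset.sum_eq_zero fun l _ => ?_
    by_cases hl : (l : ℕ) < i + k
    · rw [ih hl, zero_mul]
    · rw [hX l j (Fin.le_def.2 (by omega)), mul_zero]

variable (p N : ℕ)

/-- The monoid of upper unitriangular matrices over `ZMod p`. -/
def unitriangularSubmonoid : Submonoid (Matrix (Fin N) (Fin N) (ZMod p)) where
  carrier := {M | ∀ i j, j ≤ i → (M - 1) i j = 0}
  one_mem' := by simp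
  mul_mem' := by
    intro u v hu hv i j hij
    have h : u * v - 1 = (u - 1) * (v - 1) + (u - 1) + (v - 1) := by noncomm_ring
    rw [h, Matrix.add_apply, Matrix.add_apply, hu i j hij, hv i j hij, Matrix.mul_apply, add_zero,
      add_zero]
    refine Finset.sum_eq_zero fun l _ => ?_
    rcases le_total l i with hl | hl
    · rw [hu i l hl, zero_mul]
    · rw [hv l j (hij.trans hl), mul_zero]

variable [Fact p.Prime]

variable {p N} in
theorem pow_eq_one_of_mem_unitriangularSubmonoid {M : Matrix (Fin N) (Fin N) (ZMod p)}
    (hM : M ∈ unitriangularSubmonoid p N) : M ^ p ^ N = 1 := by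
  rcases N with _ | N
  · exact Subsingleton.elim _ _
  have h0 : (M - 1) ^ p ^ (N + 1) = 0 := by
    ext i j
    have := Nat.lt_pow_self (Fact.out : p.Prime).one_lt (n := N + 1)
    exact Matrix.pow_apply_eq_zero_of_strictlyUpper hM _ (by omega)
  -- Frobenius: (1 + X)^(p^N) = 1 + X^(p^N) for commuting matrices in characteristic p.
  have h := add_pow_char_pow_of_commute (p := p) (n := N + 1) (Commute.one_right (M - 1))
  rwa [sub_add_cancel, h0, zero_add, one_pow] at h

variable {p N} in
theorem units_pow_eq_one {u : (Matrix (Fin N) (Fin N) (ZMod p))ˣ}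
    (hu : (u : Matrix (Fin N) (Fin N) (ZMod p)) ∈ unitriangularSubmonoid p N) :
    u ^ p ^ N = 1 :=
  Units.ext <| by simpa using pow_eq_one_of_mem_unitriangularSubmonoid hu

/-- The group of upper unitriangular matrices over `ZMod p`. -/
def unitriangular : Subgroup (Matrix (Fin N) (Fin N) (ZMod p))ˣ where
  toSubmonoid := (unitriangularSubmonoid p N).comap (Units.coeHom _)
  inv_mem' := by
    intro u hu
    have hpos : 0 < p ^ N := pow_pos (Fact.out : p.Prime).pos _
    have h : u⁻¹ = u ^ (p ^ N - 1) := by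
      rw [inv_eq_iff_mul_eq_one, ← pow_succ', Nat.sub_add_cancel hpos, units_pow_eq_one hu]
    rw [h]
    exact pow_mem (S := (unitriangularSubmonoid p N).comap (Units.coeHom _)) hu _

instance : Group.IsNilpotent (unitriangular p N) := by
  have : IsPGroup p (unitriangular p N) := fun u => ⟨N, Subtype.ext (units_pow_eq_one u.2)⟩
  exact this.isNilpotent

end Unitriangular

/-! ### Matrices spelling out a word -/

section Letters

variable {ι : Type*} [DecidableEq ι] (p : ℕ) (l : List ι)

/-- The nilpotent matrix whose entry `(j, j + 1)` is `1` if the `j`-th letter of the word `l`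
is `i`, all other entries being zero. -/
def letterMatrix (i : ι) : Matrix (Fin (l.length + 1)) (Fin (l.length + 1)) (ZMod p) :=
  Matrix.of fun j k => if (k : ℕ) = j + 1 ∧ l[(j : ℕ)]? = some i then 1 else 0

variable {p l}

/-- A nonzero entry in row s of the k-th power is a path of k steps, each reading the letter i: a
run of length k starting at s. -/
theorem letterMatrix_pow_eq_zero {i : ι} {k : ℕ}
    (h : ∀ j, ¬ ∀ r < k, l[j + r]? = some i) : letterMatrix p l i ^ k = 0 := by
  have key : ∀ (k : ℕ) (s t : Fin (l.length + 1)), (letterMatrix p l i ^ k) s t ≠ 0 →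
      ∀ r < k, l[(s : ℕ) + r]? = some i := by
    intro k
    induction k with
    | zero => simp
    | succ k ih =>
      intro s t hst r hr
      rw [pow_succ', Matrix.mul_apply] at hst
      obtain ⟨u, -, hu⟩ := Finset.exists_ne_zero_of_sum_ne_zero hst
      have h1 : (u : ℕ) = s + 1 ∧ l[(s : ℕ)]? = some i := by
        by_contra h1
        exact hu (by rw [letterMatrix, Matrix.of_apply, if_neg h1, zero_mul])
      cases r with
      | zero => exact h1.2
      | succ r =>
        have := ih u t (right_ne_zero_of_mul hu) r (by omega)
        rwa [h1.1, add_assoc, add_comm 1 r] at this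
  ext s t
  by_contra hst
  exact h s (key k s t hst)

theorem one_add_letterMatrix_mem (i : ι) :
    1 + letterMatrix p l i ∈ unitriangularSubmonoid p (l.length + 1) := by
  intro j k hjk
  rw [add_sub_cancel_left, letterMatrix, Matrix.of_apply, if_neg]
  rintro ⟨h, -⟩
  have := Fin.le_def.1 hjk
  omega

/-- Each factor moves at most one step right, so column r is reached from 0 in r factors only by
stepping every time. -/
theorem prod_take_letterMatrix_apply (r : ℕ) (hr : r ≤ l.length) :
    (((l.take r).map fun i => 1 + letterMatrix p l i).prod 0 ⟨r, by omega⟩ = 1) ∧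
    ∀ j : Fin (l.length + 1), r < j →
      ((l.take r).map fun i => 1 + letterMatrix p l i).prod 0 j = 0 := by
  induction r with
  | zero =>
    refine ⟨by simp, fun j hj => ?_⟩
    have : (0 : Fin (l.length + 1)) ≠ j := by rintro rfl; simp at hj
    simp [this]
  | succ r ih =>
    obtain ⟨h1, h2⟩ := ih (by omega)
    rw [List.take_succ_eq_append_getElem (by omega), List.map_append, List.prod_append,
      List.map_singleton, List.prod_singleton]
    set P := ((l.take r).map fun i => 1 + letterMatrix p l i).prod
    refine ⟨?_, fun j hj => ?_⟩
    · rw [mul_add, mul_one, Matrix.add_apply, h2 _ (by simp), zero_add, Matrix.mul_apply,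
        Finset.sum_eq_single ⟨r, by omega⟩, h1, one_mul, letterMatrix, Matrix.of_apply, if_pos]
      · simp
      · intro s _ hs
        rw [letterMatrix, Matrix.of_apply, if_neg, mul_zero]
        rintro ⟨h, -⟩
        exact hs (Fin.ext (by simpa using h.symm))
      · simp
    · rw [mul_add, mul_one, Matrix.add_apply, h2 _ (by omega), zero_add, Matrix.mul_apply]
      refine Finset.sum_eq_zero fun s _ => ?_
      by_cases hs : r < (s : ℕ)
      · rw [h2 s hs, zero_mul]
      · rw [letterMatrix, Matrix.of_apply, if_neg, mul_zero]
        omega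

theorem exists_unitriangular_of_word [Fact p.Prime] (hl : l ≠ []) :
    ∃ A : ι → unitriangular p (l.length + 1), (l.map A).prod ≠ 1 ∧
      ∀ (i : ι) (k : ℕ), (∀ j, ¬ ∀ r < p ^ k, l[j + r]? = some i) → A i ^ p ^ k = 1 := by
  have hpow (i : ι) := pow_eq_one_of_mem_unitriangularSubmonoid (one_add_letterMatrix_mem (p := p)
    (l := l) i)
  refine ⟨fun i => ⟨Units.ofPowEqOne _ _ (hpow i) (pow_ne_zero _ (Fact.out : p.Prime).ne_zero),
    one_add_letterMatrix_mem i⟩, fun h => ?_, fun i k h => ?_⟩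
  · have h' := congrArg ((Units.coeHom _).comp (Subgroup.subtype _)) h
    rw [map_list_prod, List.map_map, map_one] at h'
    have h1 := (prod_take_letterMatrix_apply (p := p) (l := l) l.length le_rfl).1
    rw [List.take_length] at h1
    have h2 : (l.map fun i => 1 + letterMatrix p l i).prod = 1 := h'
    rw [h2, Matrix.one_apply_ne] at h1
    · exact zero_ne_one h1
    · intro h0
      exact hl (List.length_eq_zero_iff.1 (congrArg Fin.val h0).symm)
  · refine Subtype.ext (Units.ext ?_)
    change (1 + letterMatrix p l i) ^ p ^ k = 1
    rw [add_pow_char_pow_of_commute (p := p) (n := k) (Commute.one_left _),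
      letterMatrix_pow_eq_zero h, one_pow, add_zero]

end Letters

/-! ### Free products of cyclic groups -/

/-- Neighbouring blocks carry different letters, so a run stays inside one block. -/
theorem List.exists_le_of_run_flatMap_replicate {α ι : Type*} {f : α → ι} {c : α → ℕ} {T : List α}
    (hT : T.IsChain fun s s' => f s ≠ f s') (hc : ∀ s ∈ T, 0 < c s) {i : ι} {j k : ℕ}
    (hk : 0 < k)
    (h : ∀ r < k, (T.flatMap fun s => List.replicate (c s) (f s))[j + r]? = some i) :
    ∃ s ∈ T, f s = i ∧ k ≤ c s := by
  induction T generalizing j with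
  | nil => simpa using h 0 hk
  | cons s T ih =>
    rw [List.isChain_cons] at hT
    simp only [List.flatMap_cons, List.getElem?_append, List.length_replicate,
      List.getElem?_replicate] at h
    by_cases hj : j < c s
    · have hs : f s = i := by simpa [hj] using h 0 hk
      refine ⟨s, by simp, hs, ?_⟩
      by_contra hks
      have h1 := h (c s - j) (by omega)
      rw [if_neg (by omega), Nat.add_sub_cancel' hj.le, Nat.sub_self] at h1
      cases T with
      | nil => simp at h1
      | cons s' T =>
        have := hc s' (by simp)
        simp only [List.flatMap_cons, List.getElem?_append, List.length_replicate,
          List.getElem?_replicate, this, if_true, Option.some_inj] at h1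
        exact hT.1 s' (by simp) (hs.trans h1.symm)
    · obtain ⟨s', hs', h'⟩ := ih hT.2 (fun s' hs' => hc s' (by simp [hs'])) (j := j - c s) (by
        intro r hr
        have := h r hr
        rwa [if_neg (by omega), Nat.sub_add_comm (by omega)] at this)
      exact ⟨s', by simp [hs'], h'⟩

/-- The homomorphism from a cyclic group sending its generator to `x`. -/
def zmodPowersHom {G : Type*} [Group G] (q : ℕ) (x : G) (hx : x ^ q = 1) :
    Multiplicative (ZMod q) →* G :=
  AddMonoidHom.toMultiplicativeLeft
    (ZMod.lift q ⟨zmultiplesHom (Additive G) (Additive.ofMul x), by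
      simpa [← ofMul_pow] using hx⟩)

theorem zmodPowersHom_intCast {G : Type*} [Group G] (q : ℕ) (x : G) (hx : x ^ q = 1) (z : ℤ) :
    zmodPowersHom q x hx (Multiplicative.ofAdd (z : ZMod q)) = x ^ z := by
  simp [zmodPowersHom]

/-- Free products of cyclic groups, each infinite or of order a power of the prime `p`,
are residually nilpotent. -/
theorem isResiduallyNilpotent_coprodI_zmod {ι : Type} {p : ℕ} (hp : p.Prime) {q : ι → ℕ}
    (hq : ∀ i, q i = 0 ∨ ∃ k, q i = p ^ k) :
    IsResiduallyNilpotent (Monoid.CoprodI fun i => Multiplicative (ZMod (q i))) := by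
  classical
  have := Fact.mk hp
  intro g hg
  obtain ⟨w, rfl⟩ :=
    (Monoid.CoprodI.Word.equiv (M := fun i => Multiplicative (ZMod (q i)))).symm.surjective g
  change w.prod ≠ 1 at hg
  change ∃ (N : Type) (_ : Group N) (_ : Group.IsNilpotent N) (φ : _ →* N), φ w.prod ≠ 1
  let z : (Σ i, Multiplicative (ZMod (q i))) → ℤ := fun s => (s.2.toAdd).cast
  have hz (s) : Multiplicative.ofAdd ((z s : ℤ) : ZMod (q s.1)) = s.2 := by simp [z]
  let K := (w.toList.map fun s => (z s).natAbs).sum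
  have hK : ∀ s ∈ w.toList, (z s).natAbs < p ^ K := fun s hs =>
    (List.le_sum_of_mem (List.mem_map_of_mem (f := fun s => (z s).natAbs) hs)).trans_lt
      (Nat.lt_pow_self hp.one_lt)
  -- Infinite factors are reduced modulo p^K, which exceeds every exponent in the word, so no
  -- syllable becomes trivial.
  obtain ⟨k, hk⟩ : ∃ k : ι → ℕ, ∀ i, q i = 0 ∧ k i = K ∨ q i = p ^ k i := by
    have (i : ι) : ∃ k, q i = 0 ∧ k = K ∨ q i = p ^ k :=
      (hq i).elim (fun h => ⟨K, Or.inl ⟨h, rfl⟩⟩) fun ⟨k, h⟩ => ⟨k, Or.inr h⟩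
    choose k h using this
    exact ⟨k, h⟩
  let c : (Σ i, Multiplicative (ZMod (q i))) → ℕ := fun s => (z s % (p ^ k s.1 : ℕ)).toNat
  have hpos (i) : 0 < p ^ k i := pow_pos hp.pos _
  have hcz (s) : (c s : ℤ) = z s % (p ^ k s.1 : ℕ) :=
    Int.toNat_of_nonneg (Int.emod_nonneg _ (by exact_mod_cast (hpos s.1).ne'))
  have hlt (s) : c s < p ^ k s.1 := by
    have := Int.emod_lt_of_pos (z s) (b := (p ^ k s.1 : ℕ)) (by exact_mod_cast hpos s.1)
    rw [← hcz] at this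
    exact_mod_cast this
  have hc : ∀ s ∈ w.toList, 0 < c s := by
    intro s hs
    rw [Nat.pos_iff_ne_zero]
    intro h0
    have hdvd : ((p ^ k s.1 : ℕ) : ℤ) ∣ z s := Int.dvd_of_emod_eq_zero (by rw [← hcz, h0]; rfl)
    refine w.ne_one s hs ?_
    rw [← hz s, ofAdd_eq_one]
    rcases hk s.1 with ⟨-, h⟩ | h
    · rw [h] at hdvd
      rw [Int.eq_zero_of_dvd_of_natAbs_lt_natAbs hdvd (by simpa using hK s hs), Int.cast_zero]
    · rw [ZMod.intCast_zmod_eq_zero_iff_dvd, h]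
      exact hdvd
  let l := w.toList.flatMap fun s => List.replicate (c s) s.1
  have hl : l ≠ [] := by
    intro h
    refine hg ?_
    have hw : w.toList = [] := by
      refine List.eq_nil_iff_forall_not_mem.2 fun s hs => (hc s hs).ne' ?_
      simpa using List.flatMap_eq_nil_iff.1 h s hs
    simp [Monoid.CoprodI.Word.prod, hw]
  obtain ⟨A, hA, hA'⟩ := exists_unitriangular_of_word (p := p) hl
  have hApow (i) : A i ^ p ^ k i = 1 := by
    -- A run in `l` is no longer than some `c s`, which is below p^(k i).
    refine hA' i _ fun j h => ?_
    obtain ⟨s, -, rfl, hs⟩ := List.exists_le_of_run_flatMap_replicate w.chain_ne hc (hpos i) h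
    exact (hlt s).not_ge hs
  have hAq (i) : A i ^ q i = 1 := by
    rcases hk i with ⟨h, -⟩ | h
    · rw [h, pow_zero]
    · rw [h, hApow]
  refine ⟨_, inferInstance, inferInstance,
    Monoid.CoprodI.lift fun i => zmodPowersHom (q i) (A i) (hAq i), ?_⟩
  have hprod : (l.map A).prod = (w.toList.map fun s => A s.1 ^ c s).prod := by
    have (T : List (Σ i, Multiplicative (ZMod (q i)))) :
        ((T.flatMap fun s => List.replicate (c s) s.1).map A).prod =
          (T.map fun s => A s.1 ^ c s).prod := by
      induction T with
      | nil => rfl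
      | cons s T ih => simp [ih]
    exact this _
  rw [hprod] at hA
  rw [Monoid.CoprodI.Word.prod, map_list_prod, List.map_map]
  refine ne_of_eq_of_ne (congrArg List.prod (List.map_congr_left fun s _ => ?_)) hA
  rw [Function.comp_apply, Monoid.CoprodI.lift_of, ← hz s, zmodPowersHom_intCast,
    ← zpow_natCast, hcz, zpow_eq_zpow_emod' _ (hApow s.1)]

/-! ### Residual nilpotence of BS(p^k, ±p^k) -/

namespace BaumslagSolitar

/-- As n = ±m, ⟨a^m⟩ is normal, and the quotient by it receives a map from the free product through
which the projection factors. So ker θ ≤ ⟨a^m⟩. -/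
theorem mem_zpowers_of_map_coprodI {m n : ℤ} (hn : n = m ∨ n = -m) {q : BSGen → ℕ}
    (hqa : (q BSGen.a : ℤ) = m)
    (hqt : q BSGen.t = 0) (g : BaumslagSolitar m n)
    (θ : BaumslagSolitar m n →* Monoid.CoprodI fun i => Multiplicative (ZMod (q i)))
    (ha : θ (a m n) = Monoid.CoprodI.of (i := BSGen.a) (Multiplicative.ofAdd 1))
    (ht : θ (t m n) = Monoid.CoprodI.of (i := BSGen.t) (Multiplicative.ofAdd 1))
    (hg : θ g = 1) : ∃ j : ℤ, g = a m n ^ (m * j) := by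
  let Z := Subgroup.zpowers (a m n ^ m)
  have hZ : Z.Normal := by
    rw [← Subgroup.normalizer_eq_top_iff, eq_top_iff, ← closure_eq_top, Subgroup.closure_le]
    rintro _ (rfl | rfl)
    · rw [SetLike.mem_coe, Subgroup.mem_normalizer_iff_map_conj_eq, MonoidHom.map_zpowers]
      rw [MonoidHom.coe_coe, MulAut.conj_apply, ((Commute.refl (a m n)).zpow_right m).eq,
        mul_inv_cancel_right]
    · rw [SetLike.mem_coe, ← inv_mem_iff, Subgroup.mem_normalizer_iff_map_conj_eq,
        MonoidHom.map_zpowers]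
      have h : MulAut.conj (t m n)⁻¹ (a m n ^ m) = a m n ^ n := by
        rw [MulAut.conj_apply, inv_inv, relation]
      rw [MonoidHom.coe_coe, h]
      rcases hn with rfl | rfl
      · rfl
      · rw [zpow_neg, Subgroup.zpowers_inv]
  have hxa : QuotientGroup.mk' Z (a m n) ^ q BSGen.a = 1 := by
    rw [← map_pow, ← zpow_natCast, hqa]
    exact (QuotientGroup.eq_one_iff _).2 (Subgroup.mem_zpowers _)
  have hxt : QuotientGroup.mk' Z (t m n) ^ q BSGen.t = 1 := by rw [hqt, pow_zero]
  let ψ : (Monoid.CoprodI fun i => Multiplicative (ZMod (q i))) →* BaumslagSolitar m n ⧸ Z :=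
    Monoid.CoprodI.lift fun
      | .a => zmodPowersHom _ _ hxa
      | .t => zmodPowersHom _ _ hxt
  have hψ : ψ.comp θ = QuotientGroup.mk' Z := by
    refine hom_ext ?_ ?_
    · rw [MonoidHom.comp_apply, ha, Monoid.CoprodI.lift_of]
      simpa using zmodPowersHom_intCast _ _ hxa 1
    · rw [MonoidHom.comp_apply, ht, Monoid.CoprodI.lift_of]
      simpa using zmodPowersHom_intCast _ _ hxt 1
  have h : QuotientGroup.mk' Z g = 1 := by rw [← hψ, MonoidHom.comp_apply, hg, map_one]
  obtain ⟨j, hj⟩ := Subgroup.mem_zpowers_iff.1 ((QuotientGroup.eq_one_iff _).1 h)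
  exact ⟨j, by rw [zpow_mul, hj]⟩

theorem isResiduallyNilpotent_prime_pow {p k : ℕ} (hp : p.Prime) {n : ℤ}
    (hn : n = (p ^ k : ℕ) ∨ n = -(p ^ k : ℕ)) :
    IsResiduallyNilpotent (BaumslagSolitar (p ^ k : ℕ) n) := by
  intro g hg
  have hm0 : ((p ^ k : ℕ) : ℤ) ≠ 0 := by exact_mod_cast pow_ne_zero k hp.ne_zero
  let q : BSGen → ℕ := fun | .a => p ^ k | .t => 0
  have hq : ∀ i, q i = 0 ∨ ∃ k, q i = p ^ k := fun
    | .a => Or.inr ⟨k, rfl⟩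
    | .t => Or.inl rfl
  let P := Monoid.CoprodI fun i => Multiplicative (ZMod (q i))
  let x : P := Monoid.CoprodI.of (i := BSGen.a) (Multiplicative.ofAdd 1)
  let y : P := Monoid.CoprodI.of (i := BSGen.t) (Multiplicative.ofAdd 1)
  have hx : x ^ (p ^ k : ℕ) = 1 := by
    have h1 : (p ^ k) • (1 : ZMod (p ^ k)) = 0 := by simp
    have h2 : (Multiplicative.ofAdd (1 : ZMod (q BSGen.a))) ^ (p ^ k) = 1 :=
      congrArg Multiplicative.ofAdd h1
    rw [← map_pow, h2, map_one]
  have hxm : x ^ ((p ^ k : ℕ) : ℤ) = 1 := by rw [zpow_natCast, hx]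
  have hxn : x ^ n = 1 := by rcases hn with rfl | rfl <;> simp only [zpow_neg, hxm, inv_one]
  let θ : BaumslagSolitar (p ^ k : ℕ) n →* P := lift x y (by rw [hxm, hxn]; group)
  by_cases hθ : θ g = 1
  · obtain ⟨j, rfl⟩ := mem_zpowers_of_map_coprodI hn (q := q) rfl rfl g θ (lift_a _ _ _)
      (lift_t _ _ _) hθ
    have hj : (p ^ k : ℕ) * j ≠ 0 := by
      intro h
      rw [h, zpow_zero] at hg
      exact hg rfl
    obtain ⟨ε, hε, rfl⟩ : ∃ ε : ℤ, (ε = 1 ∨ ε = -1) ∧ n = (p ^ k : ℕ) * ε := by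
      rcases hn with rfl | rfl
      · exact ⟨1, by simp⟩
      · exact ⟨-1, by simp⟩
    -- In BS(1, ε) the generator `a` has infinite order, and the p^k-th power of its relation is the
    -- relation required.
    obtain ⟨N, hN, hN', φ, hφ⟩ := isResiduallyNilpotent_one (n := ε) (by omega) (by omega)
      (a 1 ε ^ ((p ^ k : ℕ) * j)) (a_zpow_ne_one one_ne_zero (by omega) hj)
    refine ⟨N, hN, hN', φ.comp (lift (a 1 ε) (t 1 ε) ?_), ?_⟩
    · have h3 := conj_zpow (i := (p ^ k : ℕ)) (a := (t 1 ε)⁻¹) (b := a 1 ε)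
      have h4 := relation 1 ε
      rw [zpow_one] at h4
      rw [inv_inv, h4] at h3
      rw [← h3, ← zpow_mul, mul_comm]
    · rwa [MonoidHom.comp_apply, map_zpow, lift_a]
  · obtain ⟨N, hN, hN', φ, hφ⟩ := isResiduallyNilpotent_coprodI_zmod hp hq (θ g) hθ
    exact ⟨N, hN, hN', φ.comp θ, hφ⟩

/-! ### The groups that are not residually nilpotent -/

theorem not_isResiduallyNilpotent_of_commute {G : Type} [Group G] {x y : G} (hxy : ¬ Commute x y)
    (h : ∀ (N : Type) [Group N] [Group.IsNilpotent N] (φ : G →* N), Commute (φ x) (φ y)) :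
    ¬ IsResiduallyNilpotent G := fun hG => by
  obtain ⟨N, hN, hN', φ, hφ⟩ := hG (x * y * x⁻¹ * y⁻¹) (mt (by
    rw [mul_inv_eq_one, mul_inv_eq_iff_eq_mul]; exact id) hxy)
  refine hφ ?_
  rw [map_mul, map_mul, map_mul, map_inv, map_inv, (h N φ).eq, mul_inv_cancel_right,
    mul_inv_cancel]

theorem not_isResiduallyNilpotent_one_two : ¬ IsResiduallyNilpotent (BaumslagSolitar 1 2) := by
  intro h
  have ha := a_zpow_ne_one (m := 1) (n := 2) one_ne_zero two_ne_zero one_ne_zero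
  rw [zpow_one] at ha
  obtain ⟨N, hN, hN', φ, hφ⟩ := h _ ha
  -- Here n - m = 1, so the image of `a` is trivial.
  obtain ⟨c, hc⟩ := Group.IsNilpotent.exists_zpow_eq_one_of_conj (map_relation φ)
  norm_num at hc
  exact hφ hc

theorem not_isResiduallyNilpotent_of_lt_abs {m n : ℤ} (hm : 1 < m) (hmn : m < |n|) :
    ¬ IsResiduallyNilpotent (BaumslagSolitar m n) := by
  have hn0 : n ≠ 0 := by rintro rfl; simp at hmn; omega
  have hne : n - m ≠ 0 := by
    intro h
    rw [sub_eq_zero.1 h, abs_of_pos (by omega)] at hmn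
    exact lt_irrefl _ hmn
  -- n does not divide the gcd, since gcd(m, n) ≤ m < |n|.
  refine not_isResiduallyNilpotent_of_commute (not_commute_conj (by omega) hn0 (x := 1)
    (y := Int.gcd m n) (fun h => ?_) fun h => ?_) fun N _ _ φ => ?_
  · have := Int.le_of_dvd one_pos h
    omega
  · have h1 := Int.le_of_dvd (by omega) ((abs_dvd n m).2 (h.trans (Int.gcd_dvd_left ..)))
    omega
  · obtain ⟨c, hc⟩ := Group.IsNilpotent.exists_zpow_eq_one_of_conj (map_relation φ)
    have hfin : IsOfFinOrder (φ (a m n)) :=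
      isOfFinOrder_iff_zpow_eq_one.2 ⟨_, pow_ne_zero c hne, hc⟩
    simpa using commute_conj_zpow_gcd (map_relation φ) hfin

theorem not_isResiduallyNilpotent_of_coprime {u v : ℕ} (hu : 1 < u) (hv : 1 < v)
    (huv : u.Coprime v) {n : ℤ} (hn : n = (u * v : ℕ) ∨ n = -(u * v : ℕ)) :
    ¬ IsResiduallyNilpotent (BaumslagSolitar (u * v : ℕ) n) := by
  have hlt : u < u * v := lt_mul_of_one_lt_right (by omega) hv
  have hlt' : v < u * v := lt_mul_of_one_lt_left (by omega) hu
  refine not_isResiduallyNilpotent_of_commute (not_commute_conj_inv (by omega) (by omega) (x := u)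
    (y := v) (fun h => ?_) fun h => ?_) fun N _ _ φ => ?_
  · have h1 : ((u * v : ℕ) : ℤ) ∣ u := by
      rcases hn with rfl | rfl
      exacts [h, (neg_dvd.1 h)]
    have := Nat.le_of_dvd (by omega) (Int.natCast_dvd_natCast.1 h1)
    omega
  · have := Nat.le_of_dvd (by omega) (Int.natCast_dvd_natCast.1 h)
    omega
  · set x := φ (a _ _) with hx
    set y := φ (t _ _) with hy
    have hrel : y⁻¹ * x ^ ((u * v : ℕ) : ℤ) * y = x ^ n := map_relation φ
    have hconj : ∀ i : ℤ, ∀ z : N, (y⁻¹ * z * y) ^ i = y⁻¹ * z ^ i * y := fun i z => by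
      have := conj_zpow (i := i) (a := y⁻¹) (b := z)
      rwa [inv_inv] at this
    have hc : Commute (x ^ n) (y⁻¹ * x ^ (v : ℤ) * y) := by
      have h1 : x ^ n = (y⁻¹ * x ^ (v : ℤ) * y) ^ (u : ℤ) := by
        rw [hconj, ← zpow_mul, ← hrel, mul_comm (v : ℤ), Nat.cast_mul]
      rw [h1]
      exact (Commute.refl _).zpow_left _
    rw [map_mul, map_mul, map_inv, map_zpow, map_zpow, ← hx, ← hy]
    -- Both (x^u)^v and (y⁻¹ x^v y)^u are x^n up to inversion, a power of x and of y⁻¹ x^v y alike.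
    refine Group.IsNilpotent.commute_of_coprime huv.symm ?_ ?_
    · rw [← zpow_natCast, ← zpow_mul, ← Nat.cast_mul]
      rcases hn with rfl | rfl
      · exact hc
      · rwa [zpow_neg, Commute.inv_left_iff] at hc
    · rw [← zpow_natCast (y⁻¹ * _ * y), hconj, ← zpow_mul, mul_comm (v : ℤ), ← Nat.cast_mul, hrel]
      exact (Commute.refl x).zpow_zpow _ _

end BaumslagSolitar

theorem Nat.exists_coprime_mul_of_not_prime_pow {m : ℕ} (hm : 1 < m)
    (h : ¬ ∃ p k : ℕ, p.Prime ∧ 0 < k ∧ m = p ^ k) :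
    ∃ u v : ℕ, 1 < u ∧ 1 < v ∧ u.Coprime v ∧ m = u * v := by
  have hp := Nat.minFac_prime hm.ne'
  have hk : 0 < m.factorization m.minFac :=
    hp.factorization_pos_of_dvd (by omega) (Nat.minFac_dvd m)
  have hmul := Nat.ordProj_mul_ordCompl_eq_self m m.minFac
  refine ⟨_, _, Nat.one_lt_pow hk.ne' hp.one_lt, ?_,
    (Nat.coprime_ordCompl hp (by omega)).pow_left _, hmul.symm⟩
  have h0 := Nat.ordCompl_pos m.minFac (show m ≠ 0 by omega)
  have h1 : m / m.minFac ^ m.factorization m.minFac ≠ 1 := by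
    intro h1
    rw [h1, mul_one] at hmul
    exact h ⟨_, _, hp, hk, hmul.symm⟩
  omega

theorem theorem2 (m n : ℤ) (hm : 0 < m) (hmn : m ≤ |n|) :
    IsResiduallyNilpotent (BaumslagSolitar m n) ↔
      (m = 1 ∧ n ≠ 2) ∨
        (|n| = m ∧ 1 < m ∧ ∃ p k : ℕ, p.Prime ∧ 0 < k ∧ m = (p : ℤ) ^ k) := by
  constructor
  · intro h
    rcases (show 1 ≤ m from hm).eq_or_lt with rfl | hm1
    · refine Or.inl ⟨rfl, ?_⟩
      rintro rfl
      exact BaumslagSolitar.not_isResiduallyNilpotent_one_two h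
    · rcases hmn.eq_or_lt with heq | hlt
      · refine Or.inr ⟨heq.symm, hm1, ?_⟩
        by_contra hpk
        lift m to ℕ using hm.le
        obtain ⟨u, v, hu, hv, huv, rfl⟩ := Nat.exists_coprime_mul_of_not_prime_pow
          (by exact_mod_cast hm1) (by exact_mod_cast hpk)
        exact BaumslagSolitar.not_isResiduallyNilpotent_of_coprime hu hv huv
          (eq_or_eq_neg_of_abs_eq heq.symm) h
      · exact absurd h (BaumslagSolitar.not_isResiduallyNilpotent_of_lt_abs hm1 hlt)
  · rintro (⟨rfl, hn⟩ | ⟨hn, -, p, k, hp, -, rfl⟩)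
    · exact BaumslagSolitar.isResiduallyNilpotent_one (by rintro rfl; simp at hmn) hn
    · have := BaumslagSolitar.isResiduallyNilpotent_prime_pow (k := k) hp (n := n)
        (eq_or_eq_neg_of_abs_eq (by exact_mod_cast hn))
      rwa [Nat.cast_pow] at this
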